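/- Let $\theta,\sigma>0$ and $\mu,x_0\in\mathbb R$, and let $(X_t)_{t\ge 0}$ be the Ornstein–Uhlenbeck process with continuous paths solving $dX_t=\theta(\mu-X_t)\,dt+\sigma\,dW_t$, $X_0=x_0$, where $W$ is a standard Brownian motion. Samples of $X$ are taken at random times $0=S_0\le S_1\le S_2\le\cdots$ and are sent through a single-server first-come first-served queue with service times $Y_0,Y_1,Y_2,\ldots\ge 0$, where $Y_1,Y_2,\ldots$ are i.i.d. with $0<\mathbb E[Y_1]<\infty$ and $Y_0$ is arbitrary (possibly constant). Thus sample $i$ is delivered at time $D_i$, where $D_0=Y_0$ and $D_{i+1}=\max\{S_{i+1},D_i\}+Y_{i+1}$. Assume that the sampling policy is signal-agnostic: the sampling times $\pi=(S_i)_i$ and the service times $(Y_i)_i$ are jointly independent of the process $X$. Let $\hat X_t=\mathbb E[X_t\mid M_t]$ be the minimum mean-squared error estimator based on the samples received by time $t$, $M_t=\{(S_i,X_{S_i},D_i): D_i\le t\}$. Let $\Delta_t=t-\max\{S_i: D_i\le t\}$ be the age of information for $t\ge D_0$, and let $\Delta_t=\Delta_0+t$ for $t<D_0$, where $\Delta_0\in\mathbb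 R$ is a given constant (the initial age). Put $$p(\delta)=\frac{\sigma^2}{2\theta}\left(1-e^{-2\theta\delta}\right).$$ Then for every $t\ge 0$ the squared error $(X_t-\hat X_t)^2$ is integrable, and almost surely on the event $\{D_0\le t\}$ (and, if $\Delta_0=0$, almost surely on the whole probability space) $$\mathbb E\left[(X_t-\hat X_t)^2\,\middle|\,\pi,Y_0,Y_1,Y_2,\ldots\right]=p(\Delta_t).$$ Moreover, $p$ is strictly increasing. -/

import Mathlib

open MeasureTheory ProbabilityTheory
open scoped NNReal

noncomputable section

namespace RemoteEstimation

variable {Ω : Type*}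

/-- `X` solves the Ornstein-Uhlenbeck equation `dX_t = θ (μ - X_t) dt + σ dW_t` with constant initial
state `x₀`, driven by the Brownian motion `W`. The noise is additive, so the equation is the pathwise
integral equation `X_t = x₀ + ∫_0^t θ (μ - X_s) ds + σ W_t`. -/
structure IsOrnsteinUhlenbeck [MeasurableSpace Ω] (P : Measure Ω) (θ μ σ x₀ : ℝ)
    (W X : ℝ≥0 → Ω → ℝ) : Prop where
  brownian : IsBrownianReal W P
  measurable : ∀ t, Measurable (X t)
  continuous_paths : ∀ ω, Continuous fun t => X t ω
  sde : ∀ᵐ ω ∂P, ∀ t : ℝ≥0,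
    X t ω = x₀ + (∫ s in (0 : ℝ)..(t : ℝ), θ * (μ - X s.toNNReal ω)) + σ * W t ω

/-- Delivery times of a single-server first-come first-served queue: sample `i` is generated at time
`S i` and has service time `Y i`; its service starts as soon as it has been generated and sample
`i - 1` has been delivered. -/
def deliveryTime (S Y : ℕ → Ω → ℝ≥0) : ℕ → Ω → ℝ≥0
  | 0, ω => S 0 ω + Y 0 ω
  | i + 1, ω => max (S (i + 1) ω) (deliveryTime S Y i ω) + Y (i + 1) ω

theorem add_le_deliveryTime (S Y : ℕ → Ω → ℝ≥0) (i : ℕ) (ω : Ω) :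
    S i ω + Y i ω ≤ deliveryTime S Y i ω := by
  cases i with
  | zero => exact le_rfl
  | succ i => exact add_le_add (le_max_left _ _) le_rfl

theorem deliveryTime_add_le (S Y : ℕ → Ω → ℝ≥0) (i : ℕ) (ω : Ω) :
    deliveryTime S Y i ω + Y (i + 1) ω ≤ deliveryTime S Y (i + 1) ω :=
  add_le_add (le_max_right _ _) le_rfl

/-- `U_t = max {S i : D i ≤ t}`, the sampling time of the freshest sample delivered by time `t`. -/
def freshestSamplingTime (S D : ℕ → Ω → ℝ≥0) (t : ℝ≥0) (ω : Ω) : ℝ≥0 :=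
  sSup {s | ∃ i, D i ω ≤ t ∧ s = S i ω}

/-- The age of information at time `t`: it is `t - U_t` once a sample has been delivered; before the
first delivery it grows at unit rate from the initial age `Δ₀`. -/
def age (Δ₀ : ℝ) (S D : ℕ → Ω → ℝ≥0) (t : ℝ≥0) (ω : Ω) : ℝ :=
  if D 0 ω ≤ t then (t : ℝ) - (freshestSamplingTime S D t ω : ℝ) else Δ₀ + (t : ℝ)

/-- The σ-field generated by the packets received by time `t`, that is, by the family
`M_t = {(S i, X_{S i}, D i) : D i ≤ t}`. -/
@[reducible] def receivedInfo (X : ℝ≥0 → Ω → ℝ) (S D : ℕ → Ω → ℝ≥0) (t : ℝ≥0) : MeasurableSpace Ω :=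
  MeasurableSpace.generateFrom
    {A | ∃ (i : ℕ) (B : Set (ℝ≥0 × ℝ × ℝ≥0)), MeasurableSet B ∧
      A = {ω | D i ω ≤ t ∧ (S i ω, X (S i ω) ω, D i ω) ∈ B}}

/-- The minimum mean-squared error estimator `E[X_t | M_t]`. -/
def estimator [MeasurableSpace Ω] (P : Measure Ω) (X : ℝ≥0 → Ω → ℝ) (S D : ℕ → Ω → ℝ≥0)
    (t : ℝ≥0) : Ω → ℝ :=
  P[X t | receivedInfo X S D t]

/-- The σ-field generated by all sampling times and all service times. -/
@[reducible] def policyServiceInfo (S Y : ℕ → Ω → ℝ≥0) : MeasurableSpace Ω :=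
  MeasurableSpace.comap (fun ω => ((fun i => S i ω), fun i => Y i ω))
    (inferInstance : MeasurableSpace ((ℕ → ℝ≥0) × (ℕ → ℝ≥0)))

/-- `S` is a sampling sequence (with `S 0 = 0`) that ignores the signal `X`: the sampling times,
jointly with the service times `Y`, are independent of the process `X`. -/
structure IsSignalAgnostic [MeasurableSpace Ω] (P : Measure Ω) (X : ℝ≥0 → Ω → ℝ)
    (S Y : ℕ → Ω → ℝ≥0) : Prop where
  measurable : ∀ i, Measurable (S i)
  zero : ∀ ω, S 0 ω = 0
  mono : ∀ i ω, S i ω ≤ S (i + 1) ω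
  indep : IndepFun (fun ω => ((fun i => S i ω), fun i => Y i ω)) (fun ω t => X t ω) P

/-- Service times: nonnegative random variables, `Y 1, Y 2, …` i.i.d. with positive finite mean.
(`Y 0`, the service time of the initial sample, is arbitrary; it may be a constant.) -/
structure IsServiceSequence [MeasurableSpace Ω] (P : Measure Ω) (Y : ℕ → Ω → ℝ≥0) : Prop where
  measurable : ∀ i, Measurable (Y i)
  indep : iIndepFun (fun i => Y (i + 1)) P
  identDistrib : ∀ i, IdentDistrib (Y (i + 1)) (Y 1) P P
  integrable : Integrable (fun ω => (Y 1 ω : ℝ)) P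
  mean_pos : 0 < ∫ ω, (Y 1 ω : ℝ) ∂P

/-- The function `p(δ) = (σ² / (2θ)) (1 - e^{-2θδ})`. -/
def agePenalty (θ σ δ : ℝ) : ℝ :=
  σ ^ 2 / (2 * θ) * (1 - Real.exp (-2 * θ * δ))

end RemoteEstimation

end

/-! Let `U` be the sampling time of the freshest sample delivered by time `t`. Variation of
constants, carried out path by path, shows that `X t` minus the forecast from `X u` equals `σ` times
the noise increments after `u`, filtered by the kernel `exp (-θ (t - u - s))`
(`sub_forecast_eq_filteredNoise`). Integration by parts turns this Wiener integral into an ordinary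
integral of the Brownian path, so Fubini and the covariance `min s t` give mean zero and variance
`(1 - exp (-2θh)) / (2θ)` with `h = t - u` (`integral_filteredNoise_sq`). The forecast error is also
independent of the signal up to `u` (`indepFun_sub_forecast`).

Since the policy is independent of the signal, `U` can be frozen: facts for deterministic `u`
integrate to facts for `U`. The error at `U` is therefore orthogonal to the σ-field of the policy
and the signal stopped at `U`. That σ-field contains the received packets, and these determine the
forecast almost surely, so the forecast is the estimator (`estimator_ae_eq`). Freezing applied to
the squared error gives `p (t - U)`. Before the first delivery `U = 0` and `X 0 = x₀` almost surely,
so the formula becomes `p t`, which is why the initial age must then vanish. -/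

namespace RemoteEstimation

variable {Ω : Type*}

/-! ### Measurability and square bounds for path integrals -/

/-- A process with continuous paths is jointly measurable in (real) time and state. -/
theorem measurable_toNNReal_path {m : MeasurableSpace Ω} {B : ℝ≥0 → Ω → ℝ}
    (hm : ∀ t, Measurable[m] (B t)) (hc : ∀ ω, Continuous fun t => B t ω) :
    Measurable fun p : ℝ × Ω => B p.1.toNNReal p.2 := by
  have h : Measurable (Function.uncurry B) :=
    measurable_uncurry_of_continuous_of_measurable hc hm
  exact h.comp ((measurable_real_toNNReal.comp measurable_fst).prodMk measurable_snd)

/-- The weighted time integral of a process with continuous paths is measurable. -/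
theorem measurable_intervalIntegral_mul_path {m : MeasurableSpace Ω} {B : ℝ≥0 → Ω → ℝ}
    (hm : ∀ t, Measurable[m] (B t)) (hc : ∀ ω, Continuous fun t => B t ω)
    {k : ℝ → ℝ} (hk : Measurable k) (a b : ℝ) :
    Measurable[m] fun ω => ∫ s in a..b, k s * B s.toNNReal ω := by
  have h : StronglyMeasurable (Function.uncurry fun (ω : Ω) (s : ℝ) => k s * B s.toNNReal ω) :=
    ((hk.comp measurable_snd).mul
      ((measurable_toNNReal_path hm hc).comp measurable_swap)).stronglyMeasurable
  simp only [intervalIntegral]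
  exact (h.integral_prod_right.sub h.integral_prod_right).measurable

/-- Cauchy-Schwarz, obtained by expanding the integral of the squared deviation of `f` from its mean
`I / h`. -/
theorem sq_intervalIntegral_le {f : ℝ → ℝ} (hf : Continuous f) {h : ℝ} (hh : 0 ≤ h) :
    (∫ s in (0 : ℝ)..h, f s) ^ 2 ≤ h * ∫ s in (0 : ℝ)..h, f s ^ 2 := by
  rcases hh.eq_or_lt with rfl | hpos
  · simp
  set I := ∫ s in (0 : ℝ)..h, f s with hI
  have h0 : 0 ≤ ∫ s in (0 : ℝ)..h, (f s - I / h) ^ 2 :=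
    intervalIntegral.integral_nonneg hh fun _ _ => sq_nonneg _
  have h1 : ∫ s in (0 : ℝ)..h, (f s - I / h) ^ 2
      = (∫ s in (0 : ℝ)..h, f s ^ 2) - 2 * (I / h) * I + h * (I / h) ^ 2 := by
    have : ∀ s, (f s - I / h) ^ 2 = f s ^ 2 - 2 * (I / h) * f s + (I / h) ^ 2 := fun s => by ring
    simp_rw [this]
    rw [intervalIntegral.integral_add, intervalIntegral.integral_sub,
      intervalIntegral.integral_const_mul, intervalIntegral.integral_const, ← hI]
    · simp
    all_goals exact Continuous.intervalIntegrable (by fun_prop) _ _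
  rw [h1] at h0
  have h2 : h * ((∫ s in (0 : ℝ)..h, f s ^ 2) - 2 * (I / h) * I + h * (I / h) ^ 2)
      = h * (∫ s in (0 : ℝ)..h, f s ^ 2) - I ^ 2 := by
    field_simp
    ring
  nlinarith [mul_nonneg hh h0]

/-- The value at time `h` of the solution of `dZ = -θ Z dt + db`, `Z 0 = 0`, integrated by parts. -/
noncomputable def filteredNoise (θ : ℝ) (h : ℝ≥0) (b : ℝ≥0 → ℝ) : ℝ :=
  b h - ∫ s in (0 : ℝ)..h, θ * Real.exp (-θ * (h - s)) * b s.toNNReal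

theorem measurable_filteredNoise {m : MeasurableSpace Ω} {B : ℝ≥0 → Ω → ℝ}
    (hm : ∀ t, Measurable[m] (B t)) (hc : ∀ ω, Continuous fun t => B t ω) (θ : ℝ) (h : ℝ≥0) :
    Measurable[m] fun ω => filteredNoise θ h fun t => B t ω :=
  (hm h).sub (measurable_intervalIntegral_mul_path hm hc
    (k := fun s => θ * Real.exp (-θ * (h - s))) (by fun_prop) 0 h)

/-! ### Moments of filtered Brownian motion -/

section Brownian

variable [MeasurableSpace Ω] {P : Measure Ω} {B : ℝ≥0 → Ω → ℝ}

theorem memLp_two_brownian (hB : IsPreBrownianReal B P) (t : ℝ≥0) : MemLp (B t) 2 P :=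
  (hB.isGaussianProcess.hasGaussianLaw_eval t).memLp_two

theorem integral_brownian_mul (hB : IsPreBrownianReal B P) (s t : ℝ≥0) :
    ∫ ω, B s ω * B t ω ∂P = min (s : ℝ) t := by
  have := hB.isGaussianProcess.isProbabilityMeasure
  have h := hB.covariance_eval s t
  rw [covariance_eq_sub (memLp_two_brownian hB s) (memLp_two_brownian hB t), hB.integral_eval,
    zero_mul, sub_zero] at h
  simpa using h

theorem integral_brownian_sq (hB : IsPreBrownianReal B P) (t : ℝ≥0) :
    ∫ ω, B t ω ^ 2 ∂P = t := by
  simpa [sq] using integral_brownian_mul hB t t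

theorem integrable_prod_mul_brownian_sq (hB : IsPreBrownianReal B P) (hm : ∀ t, Measurable (B t))
    (hc : ∀ ω, Continuous fun t => B t ω) {k : ℝ → ℝ} (hk : Continuous k) (h : ℝ≥0) :
    Integrable (fun p : ℝ × Ω => (k p.1 * B p.1.toNNReal p.2) ^ 2)
      ((volume.restrict (Set.Ioc 0 (h : ℝ))).prod P) := by
  have := hB.isGaussianProcess.isProbabilityMeasure
  have hmeas : Measurable fun p : ℝ × Ω => (k p.1 * B p.1.toNNReal p.2) ^ 2 :=
    ((hk.measurable.comp measurable_fst).mul (measurable_toNNReal_path hm hc)).pow_const 2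
  rw [integrable_prod_iff hmeas.aestronglyMeasurable]
  refine ⟨Filter.Eventually.of_forall fun s => ?_, ?_⟩
  · exact ((memLp_two_brownian hB s.toNNReal).const_mul (k s)).integrable_sq
  · have : ∀ s : ℝ, ∫ ω, ‖(k s * B s.toNNReal ω) ^ 2‖ ∂P = k s ^ 2 * (s.toNNReal : ℝ) := by
      intro s
      simp_rw [norm_pow, Real.norm_eq_abs, sq_abs, mul_pow]
      rw [integral_const_mul, integral_brownian_sq hB]
    simp_rw [this]
    exact (Continuous.integrableOn_Icc (by fun_prop)).mono_set Set.Ioc_subset_Icc_self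

theorem integrable_prod_mul_brownian_mul (hB : IsPreBrownianReal B P)
    (hm : ∀ t, Measurable (B t)) (hc : ∀ ω, Continuous fun t => B t ω)
    {k : ℝ → ℝ} (hk : Continuous k) (h : ℝ≥0) {g : Ω → ℝ} (hg : MemLp g 2 P) :
    Integrable (fun p : ℝ × Ω => k p.1 * B p.1.toNNReal p.2 * g p.2)
      ((volume.restrict (Set.Ioc 0 (h : ℝ))).prod P) := by
  have := hB.isGaussianProcess.isProbabilityMeasure
  have hmeas : Measurable fun p : ℝ × Ω => k p.1 * B p.1.toNNReal p.2 :=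
    (hk.measurable.comp measurable_fst).mul (measurable_toNNReal_path hm hc)
  have h1 : MemLp (fun p : ℝ × Ω => k p.1 * B p.1.toNNReal p.2) 2
      ((volume.restrict (Set.Ioc 0 (h : ℝ))).prod P) :=
    (memLp_two_iff_integrable_sq hmeas.aestronglyMeasurable).2
      (integrable_prod_mul_brownian_sq hB hm hc hk h)
  exact h1.integrable_mul (hg.comp_snd _)

theorem memLp_two_intervalIntegral_mul_brownian (hB : IsPreBrownianReal B P)
    (hm : ∀ t, Measurable (B t)) (hc : ∀ ω, Continuous fun t => B t ω)
    {k : ℝ → ℝ} (hk : Continuous k) (h : ℝ≥0) :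
    MemLp (fun ω => ∫ s in (0 : ℝ)..h, k s * B s.toNNReal ω) 2 P := by
  have := hB.isGaussianProcess.isProbabilityMeasure
  have hmeas := measurable_intervalIntegral_mul_path hm hc hk.measurable 0 (h : ℝ)
  rw [memLp_two_iff_integrable_sq hmeas.aestronglyMeasurable]
  have hint := (integrable_prod_mul_brownian_sq hB hm hc hk h).integral_prod_right.const_mul (h : ℝ)
  refine hint.mono' (hmeas.pow_const 2).aestronglyMeasurable (Filter.Eventually.of_forall fun ω => ?_)
  rw [norm_pow, Real.norm_eq_abs, sq_abs]
  have hcω := hc ω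
  have := sq_intervalIntegral_le (f := fun s => k s * B s.toNNReal ω)
    (by fun_prop) h.coe_nonneg
  rwa [intervalIntegral.integral_of_le (f := fun s => (k s * B s.toNNReal ω) ^ 2)
    h.coe_nonneg] at this

/-- Fubini. Taking `g` to be `1`, `B s` and the filtered noise itself yields the mean, the
covariances with `B` and the variance of the filtered noise. -/
theorem integral_intervalIntegral_mul_brownian_mul (hB : IsPreBrownianReal B P)
    (hm : ∀ t, Measurable (B t)) (hc : ∀ ω, Continuous fun t => B t ω)
    {k : ℝ → ℝ} (hk : Continuous k) (h : ℝ≥0) {g : Ω → ℝ} (hg : MemLp g 2 P) :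
    ∫ ω, (∫ s in (0 : ℝ)..h, k s * B s.toNNReal ω) * g ω ∂P
      = ∫ s in (0 : ℝ)..h, k s * ∫ ω, B s.toNNReal ω * g ω ∂P := by
  have := hB.isGaussianProcess.isProbabilityMeasure
  have hint := integrable_prod_mul_brownian_mul hB hm hc hk h hg
  simp_rw [intervalIntegral.integral_of_le h.coe_nonneg, ← integral_mul_const,
    ← integral_const_mul, ← mul_assoc]
  exact (integral_integral_swap hint).symm

theorem hasDerivAt_exp_neg_mul_sub (θ h r : ℝ) :
    HasDerivAt (fun r => Real.exp (-θ * (h - r))) (θ * Real.exp (-θ * (h - r))) r := by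
  have := (((hasDerivAt_id' r).const_sub h).const_mul (-θ)).exp
  convert this using 1
  ring

/-- The covariance of `B s` with the integral part of the filtered noise. The integral is split at
`s`, where the minimum switches. -/
theorem integral_exp_kernel_mul_min {θ : ℝ} (hθ : θ ≠ 0) {h s : ℝ} (hs : 0 ≤ s) (hsh : s ≤ h) :
    ∫ r in (0 : ℝ)..h, θ * Real.exp (-θ * (h - r)) * min r s
      = s - (Real.exp (-θ * (h - s)) - Real.exp (-θ * h)) / θ := by
  have hd := hasDerivAt_exp_neg_mul_sub θ h
  rw [← intervalIntegral.integral_add_adjacent_intervals (b := s)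
    (Continuous.intervalIntegrable (by fun_prop) _ _)
    (Continuous.intervalIntegrable (by fun_prop) _ _)]
  have h1 : ∫ r in (0 : ℝ)..s, θ * Real.exp (-θ * (h - r)) * min r s
      = ∫ r in (0 : ℝ)..s, θ * Real.exp (-θ * (h - r)) * r :=
    intervalIntegral.integral_congr fun r hr => by
      rw [Set.uIcc_of_le hs] at hr
      simp [min_eq_left hr.2]
  have h2 : ∫ r in s..h, θ * Real.exp (-θ * (h - r)) * min r s
      = ∫ r in s..h, θ * Real.exp (-θ * (h - r)) * s :=
    intervalIntegral.integral_congr fun r hr => by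
      rw [Set.uIcc_of_le hsh] at hr
      simp [min_eq_right hr.1]
  have h3 : ∫ r in (0 : ℝ)..s, θ * Real.exp (-θ * (h - r)) * r
      = (Real.exp (-θ * (h - s)) * s - Real.exp (-θ * (h - s)) / θ)
        - (Real.exp (-θ * (h - 0)) * 0 - Real.exp (-θ * (h - 0)) / θ) :=
    intervalIntegral.integral_eq_sub_of_hasDerivAt
      (f := fun r => Real.exp (-θ * (h - r)) * r - Real.exp (-θ * (h - r)) / θ)
      (fun r _ => by
        convert ((hd r).fun_mul (hasDerivAt_id' r)).fun_sub ((hd r).div_const θ) using 1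
        field_simp
        ring)
      (Continuous.intervalIntegrable (by fun_prop) _ _)
  have h4 : ∫ r in s..h, θ * Real.exp (-θ * (h - r)) * s
      = Real.exp (-θ * (h - h)) * s - Real.exp (-θ * (h - s)) * s :=
    intervalIntegral.integral_eq_sub_of_hasDerivAt
      (f := fun r => Real.exp (-θ * (h - r)) * s)
      (fun r _ => (hd r).mul_const s) (Continuous.intervalIntegrable (by fun_prop) _ _)
  rw [h1, h2, h3, h4]
  simp
  ring

/-- The integrand is the exact derivative of `(exp (-θ (h - r)) - exp (-θ h))² / (2θ)`, which
vanishes at `r = 0`. -/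
theorem integral_exp_kernel_mul_exp {θ : ℝ} (hθ : θ ≠ 0) (h : ℝ) :
    ∫ r in (0 : ℝ)..h, θ * Real.exp (-θ * (h - r)) *
        ((Real.exp (-θ * (h - r)) - Real.exp (-θ * h)) / θ)
      = (1 - Real.exp (-θ * h)) ^ 2 / (2 * θ) := by
  have hd := hasDerivAt_exp_neg_mul_sub θ h
  rw [intervalIntegral.integral_eq_sub_of_hasDerivAt
      (f := fun r => (Real.exp (-θ * (h - r)) - Real.exp (-θ * h)) ^ 2 / (2 * θ))
      (fun r _ => by
        refine ((((hd r).sub_const (Real.exp (-θ * h))).fun_pow 2).div_const (2 * θ)).congr_deriv ?_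
        field_simp
        norm_num [mul_comm])
      (Continuous.intervalIntegrable (by fun_prop) _ _)]
  simp

theorem memLp_two_filteredNoise (hB : IsPreBrownianReal B P)
    (hm : ∀ t, Measurable (B t)) (hc : ∀ ω, Continuous fun t => B t ω) (θ : ℝ) (h : ℝ≥0) :
    MemLp (fun ω => filteredNoise θ h fun t => B t ω) 2 P :=
  (memLp_two_brownian hB h).sub (memLp_two_intervalIntegral_mul_brownian hB hm hc
    (k := fun s => θ * Real.exp (-θ * (h - s))) (by fun_prop) h)

theorem integral_filteredNoise (hB : IsPreBrownianReal B P)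
    (hm : ∀ t, Measurable (B t)) (hc : ∀ ω, Continuous fun t => B t ω) (θ : ℝ) (h : ℝ≥0) :
    ∫ ω, filteredNoise θ h (fun t => B t ω) ∂P = 0 := by
  have := hB.isGaussianProcess.isProbabilityMeasure
  have hk : Continuous fun s : ℝ => θ * Real.exp (-θ * (h - s)) := by fun_prop
  have h1 := integral_intervalIntegral_mul_brownian_mul hB hm hc hk h (memLp_const (1 : ℝ))
  simp only [mul_one, hB.integral_eval, mul_zero, intervalIntegral.integral_zero] at h1
  unfold filteredNoise
  rw [integral_sub (hB.integrable_eval h)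
    ((memLp_two_intervalIntegral_mul_brownian hB hm hc hk h).integrable one_le_two), h1,
    hB.integral_eval, sub_zero]

/-- The value is the integral of `exp (-θ (h - r))` over `[0, s]`, as the Itô isometry predicts. -/
theorem integral_brownian_mul_filteredNoise (hB : IsPreBrownianReal B P)
    (hm : ∀ t, Measurable (B t)) (hc : ∀ ω, Continuous fun t => B t ω) {θ : ℝ} (hθ : θ ≠ 0)
    {s h : ℝ≥0} (hsh : s ≤ h) :
    ∫ ω, B s ω * filteredNoise θ h (fun t => B t ω) ∂P
      = (Real.exp (-θ * (h - s)) - Real.exp (-θ * h)) / θ := by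
  have hk : Continuous fun s : ℝ => θ * Real.exp (-θ * (h - s)) := by fun_prop
  have h1 := integral_intervalIntegral_mul_brownian_mul hB hm hc hk h (memLp_two_brownian hB s)
  simp_rw [integral_brownian_mul hB] at h1
  have h2 : ∫ r in (0 : ℝ)..h, θ * Real.exp (-θ * (h - r)) * min (r.toNNReal : ℝ) s
      = ∫ r in (0 : ℝ)..h, θ * Real.exp (-θ * (h - r)) * min r s :=
    intervalIntegral.integral_congr fun r hr => by
      rw [Set.uIcc_of_le h.coe_nonneg] at hr
      simp [Real.coe_toNNReal _ hr.1]
  rw [h2, integral_exp_kernel_mul_min hθ s.coe_nonneg (by exact_mod_cast hsh)] at h1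
  have h3 : ∀ ω, B s ω * filteredNoise θ h (fun t => B t ω) = B s ω * B h ω
      - (∫ s in (0 : ℝ)..h, θ * Real.exp (-θ * (h - s)) * B s.toNNReal ω) * B s ω := fun ω => by
    rw [filteredNoise]
    ring
  simp_rw [h3]
  refine (integral_sub ((memLp_two_brownian hB s).integrable_mul (memLp_two_brownian hB h))
    ((memLp_two_intervalIntegral_mul_brownian hB hm hc hk h).integrable_mul
      (memLp_two_brownian hB s))).trans ?_
  simp only [Pi.mul_apply]
  rw [h1, integral_brownian_mul hB, min_eq_left (by exact_mod_cast hsh)]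
  ring

theorem integral_filteredNoise_sq (hB : IsPreBrownianReal B P)
    (hm : ∀ t, Measurable (B t)) (hc : ∀ ω, Continuous fun t => B t ω) {θ : ℝ} (hθ : θ ≠ 0)
    (h : ℝ≥0) :
    ∫ ω, filteredNoise θ h (fun t => B t ω) ^ 2 ∂P = (1 - Real.exp (-2 * θ * h)) / (2 * θ) := by
  have hk : Continuous fun s : ℝ => θ * Real.exp (-θ * (h - s)) := by fun_prop
  have hZ := memLp_two_filteredNoise hB hm hc θ h
  have h1 := integral_intervalIntegral_mul_brownian_mul hB hm hc hk h hZ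
  have h2 : ∫ s in (0 : ℝ)..h, θ * Real.exp (-θ * (h - s)) *
        ∫ ω, B s.toNNReal ω * filteredNoise θ h (fun t => B t ω) ∂P
      = ∫ s in (0 : ℝ)..h, θ * Real.exp (-θ * (h - s)) *
        ((Real.exp (-θ * (h - s)) - Real.exp (-θ * h)) / θ) :=
    intervalIntegral.integral_congr fun s hs => by
      rw [Set.uIcc_of_le h.coe_nonneg] at hs
      have hsh : s.toNNReal ≤ h := Real.toNNReal_le_iff_le_coe.2 hs.2
      simp only [integral_brownian_mul_filteredNoise hB hm hc hθ hsh, Real.coe_toNNReal _ hs.1]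
  rw [h2, integral_exp_kernel_mul_exp hθ] at h1
  -- Only one of the two factors is expanded, so the covariances of the noise with `B` suffice.
  have h3 : ∀ ω, filteredNoise θ h (fun t => B t ω) ^ 2
      = B h ω * filteredNoise θ h (fun t => B t ω)
        - (∫ s in (0 : ℝ)..h, θ * Real.exp (-θ * (h - s)) * B s.toNNReal ω)
          * filteredNoise θ h (fun t => B t ω) := fun ω => by
    rw [← sub_mul, sq]; rfl
  simp_rw [h3]
  refine (integral_sub ((memLp_two_brownian hB h).integrable_mul hZ)
    ((memLp_two_intervalIntegral_mul_brownian hB hm hc hk h).integrable_mul hZ)).trans ?_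
  simp only [Pi.mul_apply]
  rw [h1, integral_brownian_mul_filteredNoise hB hm hc hθ le_rfl]
  -- With `a = exp (-θ h)`, what remains is `(1 - a) / θ - (1 - a)² / (2θ) = (1 - a²) / (2θ)`.
  have h4 : Real.exp (-2 * θ * h) = Real.exp (-θ * h) ^ 2 := by
    rw [← Real.exp_nat_mul]; congr 1; push_cast; ring
  rw [h4]
  simp
  field_simp
  ring

end Brownian

/-! ### Forecast errors of the Ornstein-Uhlenbeck process -/

/-- The conditional mean of the Ornstein-Uhlenbeck process `h` time units after it was at `x`. -/
noncomputable def forecast (θ μ h x : ℝ) : ℝ := μ + (x - μ) * Real.exp (-θ * h)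

theorem sub_forecast_eq_filteredNoise {θ μ σ x₀ : ℝ} {x w : ℝ≥0 → ℝ} (hx : Continuous x)
    (hsde : ∀ t : ℝ≥0, x t = x₀ + (∫ s in (0 : ℝ)..(t : ℝ), θ * (μ - x s.toNNReal)) + σ * w t)
    {u t : ℝ≥0} (hut : u ≤ t) :
    x t - forecast θ μ (t - u) (x u) = σ * filteredNoise θ (t - u) fun r => w (u + r) - w u := by
  have hut' : (u : ℝ) ≤ t := by exact_mod_cast hut
  have hcont : Continuous fun s : ℝ => θ * (μ - x s.toNNReal) := by fun_prop
  -- At nonnegative times `z = x - σ w`; unlike `x`, it is differentiable.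
  set z : ℝ → ℝ := fun v => x₀ + ∫ s in (0 : ℝ)..v, θ * (μ - x s.toNNReal) with hz
  have hzd : ∀ s, HasDerivAt z (θ * (μ - x s.toNNReal)) s := fun s =>
    (intervalIntegral.integral_hasDerivAt_right (hcont.intervalIntegrable _ _)
      (hcont.stronglyMeasurableAtFilter _ _) hcont.continuousAt).const_add x₀
  have hzc : Continuous z := continuous_iff_continuousAt.2 fun s => (hzd s).continuousAt
  -- The constant `σ * w u` is added so that only the increments `w s - w u` survive in the
  -- integrand.
  have hFTC : ∫ s in (u : ℝ)..t, (θ * Real.exp (-θ * (t - s)) * (z s - μ + σ * w u)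
        + Real.exp (-θ * (t - s)) * (θ * (μ - x s.toNNReal)))
      = Real.exp (-θ * (t - t)) * (z t - μ + σ * w u)
        - Real.exp (-θ * (t - u)) * (z u - μ + σ * w u) :=
    intervalIntegral.integral_eq_sub_of_hasDerivAt
      (f := fun s => Real.exp (-θ * (t - s)) * (z s - μ + σ * w u))
      (fun s _ => (hasDerivAt_exp_neg_mul_sub θ t s).mul (((hzd s).sub_const μ).add_const _))
      (Continuous.intervalIntegrable (by fun_prop) _ _)
  have hcongr : ∫ s in (u : ℝ)..t, (θ * Real.exp (-θ * (t - s)) * (z s - μ + σ * w u)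
        + Real.exp (-θ * (t - s)) * (θ * (μ - x s.toNNReal)))
      = ∫ s in (u : ℝ)..t,
        -σ * (θ * Real.exp (-θ * (t - s)) * (w s.toNNReal - w u)) :=
    intervalIntegral.integral_congr fun s hs => by
      rw [Set.uIcc_of_le hut'] at hs
      have h := hsde s.toNNReal
      rw [Real.coe_toNNReal _ (u.coe_nonneg.trans hs.1)] at h
      have h' : z s = x s.toNNReal - σ * w s.toNNReal := by rw [h]; simp [hz]
      simp only [h']
      ring
  have hshift : ∫ s in (0 : ℝ)..(t - u : ℝ),
        θ * Real.exp (-θ * ((t - u) - s)) * (w (u + s.toNNReal) - w u)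
      = ∫ s in (u : ℝ)..t, θ * Real.exp (-θ * (t - s)) * (w s.toNNReal - w u) := by
    have := intervalIntegral.integral_comp_add_left (a := 0) (b := (t - u : ℝ))
      (fun s : ℝ => θ * Real.exp (-θ * (t - s)) * (w s.toNNReal - w u)) (u : ℝ)
    rw [add_zero, add_sub_cancel] at this
    rw [← this]
    refine intervalIntegral.integral_congr fun s hs => ?_
    rw [Set.uIcc_of_le (sub_nonneg.2 hut')] at hs
    simp only [Real.toNNReal_add u.coe_nonneg hs.1, Real.toNNReal_coe, sub_add_eq_sub_sub]
  rw [hcongr, intervalIntegral.integral_const_mul, ← hshift] at hFTC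
  have hzt : z t = x t - σ * w t := by rw [hsde t]; simp [hz]
  have hzu : z u = x u - σ * w u := by rw [hsde u]; simp [hz]
  rw [hzt, hzu, sub_self, mul_zero, Real.exp_zero] at hFTC
  rw [filteredNoise, NNReal.coe_sub hut, add_tsub_cancel_of_le hut, forecast]
  linear_combination -hFTC

section OrnsteinUhlenbeck

variable [MeasurableSpace Ω] {P : Measure Ω} {θ μ σ x₀ : ℝ} {W X : ℝ≥0 → Ω → ℝ}

/-- The Brownian motion driving an Ornstein-Uhlenbeck process may be taken measurable, with all
paths continuous and with the equation valid everywhere. -/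
theorem IsOrnsteinUhlenbeck.exists_regular_brownian (hX : IsOrnsteinUhlenbeck P θ μ σ x₀ W X)
    (hσ : σ ≠ 0) :
    ∃ B : ℝ≥0 → Ω → ℝ, IsPreBrownianReal B P ∧ (∀ t, Measurable (B t)) ∧
      (∀ ω, Continuous fun t => B t ω) ∧ ∀ ω, ∀ t : ℝ≥0,
        X t ω = x₀ + (∫ s in (0 : ℝ)..(t : ℝ), θ * (μ - X s.toNNReal ω)) + σ * B t ω := by
  have hc : ∀ ω, Continuous fun s : ℝ => θ * (μ - X s.toNNReal ω) := fun ω => by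
    have := hX.continuous_paths ω
    fun_prop
  -- The equation is solved for the noise: the result agrees with `W` almost surely and inherits
  -- measurability and continuity from `X`.
  refine ⟨fun t ω => (X t ω - x₀ - ∫ s in (0 : ℝ)..(t : ℝ), θ * (μ - X s.toNNReal ω)) / σ,
    ?_, fun t => ?_, fun ω => ?_, fun ω t => ?_⟩
  · refine hX.brownian.toIsPreBrownianReal.congr fun t => ?_
    filter_upwards [hX.sde] with ω hω
    rw [hω t]
    field_simp
    ring
  · exact (((hX.measurable t).sub_const x₀).sub (measurable_intervalIntegral_mul_path
      (B := fun t ω => μ - X t ω) (fun t => (hX.measurable t).const_sub μ)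
      (fun ω => continuous_const.sub (hX.continuous_paths ω)) measurable_const 0 t)).div_const σ
  · have h1 := hX.continuous_paths ω
    have h2 : Continuous fun v : ℝ => ∫ s in (0 : ℝ)..v, θ * (μ - X s.toNNReal ω) :=
      intervalIntegral.continuous_primitive (fun a b => (hc ω).intervalIntegrable a b) 0
    have h3 := h2.comp NNReal.continuous_coe
    exact ((h1.sub continuous_const).sub h3).div_const σ
  · field_simp
    ring

theorem IsOrnsteinUhlenbeck.eval_zero (hX : IsOrnsteinUhlenbeck P θ μ σ x₀ W X) :
    ∀ᵐ ω ∂P, X 0 ω = x₀ := by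
  filter_upwards [hX.sde, hX.brownian.eval_zero_ae_eq_zero] with ω h h0
  simpa [h0] using h 0

theorem IsOrnsteinUhlenbeck.memLp_two_sub_forecast (hX : IsOrnsteinUhlenbeck P θ μ σ x₀ W X)
    (hσ : σ ≠ 0) {u t : ℝ≥0} (hut : u ≤ t) :
    MemLp (fun ω => X t ω - forecast θ μ (t - u) (X u ω)) 2 P := by
  obtain ⟨B, hB, hm, hc, hsde⟩ := hX.exists_regular_brownian hσ
  simp_rw [fun ω => sub_forecast_eq_filteredNoise (hX.continuous_paths ω) (hsde ω) hut]
  exact (memLp_two_filteredNoise (hB.shift u) (fun t => (hm _).sub (hm _))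
    (fun ω => by have := hc ω; fun_prop) θ (t - u)).const_mul σ

theorem IsOrnsteinUhlenbeck.integral_sub_forecast (hX : IsOrnsteinUhlenbeck P θ μ σ x₀ W X)
    (hσ : σ ≠ 0) {u t : ℝ≥0} (hut : u ≤ t) :
    ∫ ω, (X t ω - forecast θ μ (t - u) (X u ω)) ∂P = 0 := by
  obtain ⟨B, hB, hm, hc, hsde⟩ := hX.exists_regular_brownian hσ
  simp_rw [fun ω => sub_forecast_eq_filteredNoise (hX.continuous_paths ω) (hsde ω) hut]
  rw [integral_const_mul, integral_filteredNoise (hB.shift u) (fun t => (hm _).sub (hm _))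
    (fun ω => by have := hc ω; fun_prop), mul_zero]

theorem IsOrnsteinUhlenbeck.integral_sub_forecast_sq (hX : IsOrnsteinUhlenbeck P θ μ σ x₀ W X)
    (hθ : θ ≠ 0) (hσ : σ ≠ 0) {u t : ℝ≥0} (hut : u ≤ t) :
    ∫ ω, (X t ω - forecast θ μ (t - u) (X u ω)) ^ 2 ∂P = agePenalty θ σ (t - u) := by
  obtain ⟨B, hB, hm, hc, hsde⟩ := hX.exists_regular_brownian hσ
  simp_rw [fun ω => sub_forecast_eq_filteredNoise (hX.continuous_paths ω) (hsde ω) hut,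
    mul_pow]
  rw [integral_const_mul, integral_filteredNoise_sq (hB.shift u) (fun t => (hm _).sub (hm _))
    (fun ω => by have := hc ω; fun_prop) hθ, NNReal.coe_sub hut, agePenalty]
  ring

/-- The forecast error is independent of the past of the process. -/
theorem IsOrnsteinUhlenbeck.indepFun_sub_forecast (hX : IsOrnsteinUhlenbeck P θ μ σ x₀ W X)
    (hσ : σ ≠ 0) {u t : ℝ≥0} (hut : u ≤ t) :
    IndepFun (fun ω => X t ω - forecast θ μ (t - u) (X u ω))
      (fun ω r => X (min r u) ω) P := by
  obtain ⟨B, hB, hm, hc, hsde⟩ := hX.exists_regular_brownian hσ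
  have hXc := hX.continuous_paths
  have hind := hB.indepFun_shift u
  rw [IndepFun_iff_Indep] at hind ⊢
  refine indep_of_indep_of_le_left (indep_of_indep_of_le_right hind ?_) ?_
  -- Past: `X` stopped at `u` is a functional of `B` on `[0, u]`, by variation of constants from
  -- time `0`.
  · set m : MeasurableSpace Ω := MeasurableSpace.comap
      (fun ω (t : Set.Iic u) => B t ω) inferInstance
    have hBm : ∀ r, r ≤ u → Measurable[m] (B r) := fun r hr =>
      (measurable_pi_apply (⟨r, hr⟩ : Set.Iic u)).comp
        (comap_measurable fun ω (t : Set.Iic u) => B t ω)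
    have h0 : Measurable[m] (X 0) := by
      have : X 0 = fun ω => x₀ + σ * B 0 ω := by
        funext ω
        simpa using hsde ω 0
      rw [this]
      exact ((hBm 0 zero_le).const_mul σ).const_add x₀
    refine Measurable.comap_le (measurable_pi_lambda _ fun r => ?_)
    set v := min r u
    have hvu : v ≤ u := min_le_right _ _
    have hv : X v = fun ω => forecast θ μ v (X 0 ω)
        + σ * filteredNoise θ v fun s => B (min s u) ω - B 0 ω := by
      funext ω
      have h := sub_forecast_eq_filteredNoise (hXc ω) (hsde ω)
        (zero_le (a := v))
      simp only [NNReal.coe_zero, sub_zero, tsub_zero, zero_add] at h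
      -- `measurable_filteredNoise` asks for measurability at all times, so `B` is stopped at `u`;
      -- up to the horizon `v ≤ u` this changes nothing.
      have h' : filteredNoise θ v (fun s => B (min s u) ω - B 0 ω)
          = filteredNoise θ v fun s => B s ω - B 0 ω := by
        simp only [filteredNoise, min_eq_left hvu]
        congr 1
        refine intervalIntegral.integral_congr fun s hs => ?_
        rw [Set.uIcc_of_le v.coe_nonneg] at hs
        have : s.toNNReal ≤ u := (Real.toNNReal_le_iff_le_coe.2 hs.2).trans hvu
        simp only [min_eq_left this]
      rw [h', ← h]
      ring
    rw [hv]
    refine Measurable.add (((h0.sub_const μ).mul_const _).const_add μ)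
      ((measurable_filteredNoise (B := fun s ω => B (min s u) ω - B 0 ω)
        (fun s => (hBm _ (min_le_right _ _)).sub (hBm 0 zero_le))
        (fun ω => ?_) θ v).const_mul σ)
    have := hc ω
    fun_prop
  -- Future: the error is a functional of the increments of `B` after `u`.
  · set m : MeasurableSpace Ω := MeasurableSpace.comap
      (fun ω t => B (u + t) ω - B u ω) inferInstance
    refine Measurable.comap_le ?_
    simp_rw [fun ω => sub_forecast_eq_filteredNoise (hXc ω) (hsde ω) hut]
    refine (measurable_filteredNoise (B := fun s ω => B (u + s) ω - B u ω)
      (fun s => (measurable_pi_apply s).comp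
        (comap_measurable fun ω t => B (u + t) ω - B u ω)) (fun ω => ?_) θ _).const_mul σ
    have := hc ω
    fun_prop

end OrnsteinUhlenbeck

/-! ### Freezing one of two independent variables -/

section Freezing

variable {E F : Type*} [MeasurableSpace Ω] [MeasurableSpace E] [MeasurableSpace F]
  {P : Measure Ω} [IsProbabilityMeasure P] {Z : Ω → E} {V : Ω → F} {f : E × F → ℝ}

/-- Under the product law, sections with uniformly bounded `L¹` norm suffice, because the law of `Z`
is finite. -/
theorem integrable_comp_of_indepFun (hZ : Measurable Z) (hV : Measurable V)
    (hind : IndepFun Z V P) (hf : Measurable f)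
    (hint : ∀ z, Integrable (fun ω => f (z, V ω)) P) {C : ℝ}
    (hC : ∀ z, ∫ ω, ‖f (z, V ω)‖ ∂P ≤ C) : Integrable (fun ω => f (Z ω, V ω)) P := by
  have := Measure.isProbabilityMeasure_map (μ := P) hZ.aemeasurable
  have := Measure.isProbabilityMeasure_map (μ := P) hV.aemeasurable
  have hmap := (indepFun_iff_map_prod_eq_prod_map_map hZ.aemeasurable hV.aemeasurable).1 hind
  refine (integrable_map_measure (g := f) hf.aestronglyMeasurable
    (hZ.prodMk hV).aemeasurable).1 ?_
  rw [hmap, integrable_prod_iff hf.aestronglyMeasurable]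
  refine ⟨Filter.Eventually.of_forall fun z => (integrable_map_measure
    (hf.comp measurable_prodMk_left).aestronglyMeasurable hV.aemeasurable).2 (hint z), ?_⟩
  refine Integrable.of_bound (C := C)
    hf.norm.stronglyMeasurable.integral_prod_right'.aestronglyMeasurable
    (Filter.Eventually.of_forall fun z => ?_)
  rw [integral_map (f := fun y => ‖f (z, y)‖) hV.aemeasurable
    (hf.comp measurable_prodMk_left).norm.aestronglyMeasurable, Real.norm_of_nonneg (integral_nonneg fun _ => norm_nonneg _)]
  exact hC z

theorem integral_comp_of_indepFun (hZ : Measurable Z) (hV : Measurable V)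
    (hind : IndepFun Z V P) (hf : Measurable f) (hint : Integrable (fun ω => f (Z ω, V ω)) P) :
    ∫ ω, f (Z ω, V ω) ∂P = ∫ ω, ∫ ω', f (Z ω, V ω') ∂P ∂P := by
  have := Measure.isProbabilityMeasure_map (μ := P) hZ.aemeasurable
  have := Measure.isProbabilityMeasure_map (μ := P) hV.aemeasurable
  have hmap := (indepFun_iff_map_prod_eq_prod_map_map hZ.aemeasurable hV.aemeasurable).1 hind
  have hint' := (integrable_map_measure (g := f) hf.aestronglyMeasurable
    (hZ.prodMk hV).aemeasurable).2 hint
  rw [← integral_map (f := f) (hZ.prodMk hV).aemeasurable hf.aestronglyMeasurable, hmap]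
  rw [hmap] at hint'
  rw [integral_prod _ hint', integral_map hZ.aemeasurable
    hf.stronglyMeasurable.integral_prod_right'.aestronglyMeasurable]
  exact integral_congr_ae (Filter.Eventually.of_forall fun ω =>
    integral_map hV.aemeasurable (hf.comp measurable_prodMk_left).aestronglyMeasurable)

theorem condExp_comap_comp_of_indepFun (hZ : Measurable Z) (hV : Measurable V)
    (hind : IndepFun Z V P) (hf : Measurable f) (hint : Integrable (fun ω => f (Z ω, V ω)) P)
    {q : E → ℝ} (hq : Measurable q) (hfq : ∀ z, ∫ ω, f (z, V ω) ∂P = q z)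
    (hqint : Integrable (fun ω => q (Z ω)) P) :
    P[fun ω => f (Z ω, V ω) | MeasurableSpace.comap Z inferInstance] =ᵐ[P] fun ω => q (Z ω) := by
  symm
  refine ae_eq_condExp_of_forall_setIntegral_eq hZ.comap_le hint (fun _ _ _ => hqint.integrableOn)
    (fun A hA _ => ?_)
    (hq.comp (comap_measurable Z)).stronglyMeasurable.aestronglyMeasurable
  obtain ⟨B, hB, rfl⟩ := hA
  have hA := hZ hB
  -- The event depends on `Z` alone, so its indicator is absorbed into the function being frozen.
  have hf' : Measurable ((Prod.fst ⁻¹' B).indicator f) := hf.indicator (measurable_fst hB)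
  have h1 : ∀ ω, (Z ⁻¹' B).indicator (fun ω => f (Z ω, V ω)) ω
      = (Prod.fst ⁻¹' B).indicator f (Z ω, V ω) := fun ω => rfl
  rw [← integral_indicator hA, ← integral_indicator hA]
  simp_rw [h1]
  rw [integral_comp_of_indepFun hZ hV hind hf' ((hint.indicator hA).congr
    (Filter.Eventually.of_forall h1))]
  refine integral_congr_ae (Filter.Eventually.of_forall fun ω => ?_)
  by_cases h : Z ω ∈ B
  · simp [Set.indicator, h, hfq]
  · simp [Set.indicator, h]

end Freezing

/-! ### Forecasting from a random sampling time -/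

/-- Continuous trajectories, with the σ-field generated by the evaluations. -/
abbrev ContinuousPath : Type := {x : ℝ≥0 → ℝ // Continuous x}

/-- Continuity is essential: on the space of all functions with the product σ-field, evaluation is
not jointly measurable in time and path. A random sampling time needs the joint statement. -/
theorem measurable_continuousPath_eval :
    Measurable fun p : ℝ≥0 × ContinuousPath => p.2.1 p.1 :=
  measurable_uncurry_of_continuous_of_measurable (u := fun t (x : ContinuousPath) => x.1 t)
    (fun x => x.2) fun t => (measurable_pi_apply t).comp measurable_subtype_coe

/-- The trajectory of a process with continuous paths. -/
def toContinuousPath (X : ℝ≥0 → Ω → ℝ) (hc : ∀ ω, Continuous fun t => X t ω) (ω : Ω) :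
    ContinuousPath := ⟨fun t => X t ω, hc ω⟩

theorem indepFun_toContinuousPath [MeasurableSpace Ω] {P : Measure Ω} {E : Type*}
    [MeasurableSpace E] {Z : Ω → E} {X : ℝ≥0 → Ω → ℝ} (hc : ∀ ω, Continuous fun t => X t ω)
    (hind : IndepFun Z (fun ω t => X t ω) P) : IndepFun Z (toContinuousPath X hc) P := by
  rw [IndepFun_iff_Indep] at hind ⊢
  convert hind using 1
  exact MeasurableSpace.comap_comp

/-- The stationary variance bounds the error uniformly in the age; this gives integrability at a
random sampling time. -/
theorem agePenalty_le {θ σ δ : ℝ} (hθ : 0 < θ) : agePenalty θ σ δ ≤ σ ^ 2 / (2 * θ) :=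
  mul_le_of_le_one_right (by positivity) (by linarith [Real.exp_pos (-2 * θ * δ)])

theorem agePenalty_strictMono {θ σ : ℝ} (hθ : 0 < θ) (hσ : σ ≠ 0) :
    StrictMono (agePenalty θ σ) := fun a b hab => by
  have h : -2 * θ * b < -2 * θ * a := by nlinarith
  exact mul_lt_mul_of_pos_left (sub_lt_sub_left (Real.exp_lt_exp.2 h) 1) (by positivity)

@[fun_prop]
theorem measurable_agePenalty (θ σ : ℝ) : Measurable (agePenalty θ σ) := by
  unfold agePenalty
  fun_prop

section RandomLastSample

variable [MeasurableSpace Ω] {P : Measure Ω} [IsProbabilityMeasure P] {θ μ σ x₀ : ℝ}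
  {W X : ℝ≥0 → Ω → ℝ} {E : Type*} [MeasurableSpace E] {Z : Ω → E} {g : E → ℝ≥0} {t : ℝ≥0}

theorem measurable_path_sub_forecast (θ μ : ℝ) (hg : Measurable g) (t : ℝ≥0) :
    Measurable fun p : E × ContinuousPath =>
      p.2.1 t - forecast θ μ (t - g p.1) (p.2.1 (g p.1)) := by
  have h1 : Measurable fun p : E × ContinuousPath => p.2.1 t :=
    measurable_continuousPath_eval.comp (measurable_const.prodMk measurable_snd)
  have h2 : Measurable fun p : E × ContinuousPath => p.2.1 (g p.1) :=
    measurable_continuousPath_eval.comp ((hg.comp measurable_fst).prodMk measurable_snd)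
  have h3 : Measurable fun p : E × ContinuousPath => g p.1 := hg.comp measurable_fst
  unfold forecast
  fun_prop

theorem measurable_toContinuousPath (hm : ∀ t, Measurable (X t))
    (hc : ∀ ω, Continuous fun t => X t ω) : Measurable (toContinuousPath X hc) :=
  (measurable_pi_lambda _ hm).subtype_mk

theorem IsOrnsteinUhlenbeck.integrable_sub_forecast_sq_of_indepFun
    (hX : IsOrnsteinUhlenbeck P θ μ σ x₀ W X) (hθ : 0 < θ) (hσ : σ ≠ 0)
    (hZ : Measurable Z) (hind : IndepFun Z (fun ω t => X t ω) P) (hg : Measurable g)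
    (hgt : ∀ z, g z ≤ t) :
    Integrable (fun ω => (X t ω - forecast θ μ (t - g (Z ω)) (X (g (Z ω)) ω)) ^ 2) P := by
  refine integrable_comp_of_indepFun hZ
    (measurable_toContinuousPath hX.measurable hX.continuous_paths)
    (indepFun_toContinuousPath hX.continuous_paths hind)
    ((measurable_path_sub_forecast θ μ hg t).pow_const 2)
    (fun z => (hX.memLp_two_sub_forecast hσ (hgt z)).integrable_sq) (C := σ ^ 2 / (2 * θ))
    fun z => ?_
  simp_rw [norm_pow, Real.norm_eq_abs, sq_abs]
  exact (hX.integral_sub_forecast_sq hθ.ne' hσ (hgt z)).trans_le (agePenalty_le hθ)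

theorem IsOrnsteinUhlenbeck.condExp_sub_forecast_sq_of_indepFun
    (hX : IsOrnsteinUhlenbeck P θ μ σ x₀ W X) (hθ : 0 < θ) (hσ : σ ≠ 0)
    (hZ : Measurable Z) (hind : IndepFun Z (fun ω t => X t ω) P) (hg : Measurable g)
    (hgt : ∀ z, g z ≤ t) :
    P[fun ω => (X t ω - forecast θ μ (t - g (Z ω)) (X (g (Z ω)) ω)) ^ 2 |
        MeasurableSpace.comap Z inferInstance]
      =ᵐ[P] fun ω => agePenalty θ σ (t - g (Z ω)) := by
  have hq : Measurable fun z => agePenalty θ σ (t - g z) := by fun_prop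
  refine condExp_comap_comp_of_indepFun hZ
    (measurable_toContinuousPath hX.measurable hX.continuous_paths)
    (indepFun_toContinuousPath hX.continuous_paths hind)
    ((measurable_path_sub_forecast θ μ hg t).pow_const 2)
    (hX.integrable_sub_forecast_sq_of_indepFun hθ hσ hZ hind hg hgt) hq
    (fun z => hX.integral_sub_forecast_sq hθ.ne' hσ (hgt z)) ?_
  refine Integrable.of_bound (C := σ ^ 2 / (2 * θ)) (hq.comp hZ).aestronglyMeasurable
    (Filter.Eventually.of_forall fun ω => ?_)
  rw [← hX.integral_sub_forecast_sq hθ.ne' hσ (hgt (Z ω)),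
    Real.norm_of_nonneg (integral_nonneg fun _ => sq_nonneg _),
    hX.integral_sub_forecast_sq hθ.ne' hσ (hgt (Z ω))]
  exact agePenalty_le hθ

theorem IsOrnsteinUhlenbeck.integrable_sub_forecast_of_indepFun
    (hX : IsOrnsteinUhlenbeck P θ μ σ x₀ W X) (hθ : 0 < θ) (hσ : σ ≠ 0)
    (hZ : Measurable Z) (hind : IndepFun Z (fun ω t => X t ω) P) (hg : Measurable g)
    (hgt : ∀ z, g z ≤ t) :
    Integrable (fun ω => X t ω - forecast θ μ (t - g (Z ω)) (X (g (Z ω)) ω)) P := by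
  have hm : Measurable fun ω => X t ω - forecast θ μ (t - g (Z ω)) (X (g (Z ω)) ω) :=
    (measurable_path_sub_forecast θ μ hg t).comp
      (hZ.prodMk (measurable_toContinuousPath hX.measurable hX.continuous_paths))
  exact ((memLp_two_iff_integrable_sq hm.aestronglyMeasurable).2
    (hX.integrable_sub_forecast_sq_of_indepFun hθ hσ hZ hind hg hgt)).integrable one_le_two

/-- The forecast error is orthogonal to everything known from the policy and from the trajectory
up to the last sampling time. -/
theorem IsOrnsteinUhlenbeck.setIntegral_sub_forecast_of_indepFun
    (hX : IsOrnsteinUhlenbeck P θ μ σ x₀ W X) (hθ : 0 < θ) (hσ : σ ≠ 0)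
    (hZ : Measurable Z) (hind : IndepFun Z (fun ω t => X t ω) P) (hg : Measurable g)
    (hgt : ∀ z, g z ≤ t) {A : Set Ω}
    (hA : MeasurableSet[MeasurableSpace.comap
      (fun ω => (Z ω, fun r => X (min r (g (Z ω))) ω)) inferInstance] A) :
    ∫ ω in A, (X t ω - forecast θ μ (t - g (Z ω)) (X (g (Z ω)) ω)) ∂P = 0 := by
  obtain ⟨B, hB, rfl⟩ := hA
  have hV := measurable_toContinuousPath hX.measurable hX.continuous_paths
  have hpast : Measurable fun p : E × ContinuousPath =>
      (p.1, fun r => p.2.1 (min r (g p.1))) :=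
    measurable_fst.prodMk (measurable_pi_lambda _ fun r => measurable_continuousPath_eval.comp
      ((measurable_const.min (hg.comp measurable_fst)).prodMk measurable_snd))
  have hA := (hpast.comp (hZ.prodMk hV)) hB
  have hint := hX.integrable_sub_forecast_of_indepFun hθ hσ hZ hind hg hgt
  refine (integral_indicator hA).symm.trans ?_
  refine (integral_comp_of_indepFun hZ hV (indepFun_toContinuousPath hX.continuous_paths hind)
    ((measurable_path_sub_forecast θ μ hg t).indicator (hpast hB))
    (hint.indicator hA)).trans ?_
  rw [← integral_zero Ω ℝ (μ := P)]
  refine integral_congr_ae (Filter.Eventually.of_forall fun ω => ?_)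
  set z := Z ω
  have hBz : MeasurableSet (Prod.mk z ⁻¹' B) := measurable_prodMk_left hB
  -- Once `Z = z` is frozen, the event concerns only the signal up to `g z`, hence is independent of
  -- the centred error.
  have hprod : ∀ ω', ((fun p : E × ContinuousPath => (p.1, fun r => p.2.1 (min r (g p.1)))) ⁻¹'
        B).indicator (fun p => p.2.1 t - forecast θ μ (t - g p.1) (p.2.1 (g p.1)))
        (z, toContinuousPath X hX.continuous_paths ω')
      = (X t ω' - forecast θ μ (t - g z) (X (g z) ω'))
        * (Prod.mk z ⁻¹' B).indicator 1 (fun r => X (min r (g z)) ω') := fun ω' => by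
    by_cases h : (z, fun r => X (min r (g z)) ω') ∈ B
    · simp [Set.indicator, toContinuousPath, h]
    · simp [Set.indicator, toContinuousPath, h]
  refine (integral_congr_ae (Filter.Eventually.of_forall hprod)).trans ?_
  have hi := (hX.indepFun_sub_forecast hσ (hgt z)).comp measurable_id
    ((measurable_one (α := ℝ)).indicator hBz)
  refine (hi.integral_fun_mul_eq_mul_integral
    (hX.memLp_two_sub_forecast hσ (hgt z)).aestronglyMeasurable ?_).trans ?_
  · exact (((measurable_one (α := ℝ)).indicator hBz).comp
      (measurable_pi_lambda _ fun r => hX.measurable _)).aestronglyMeasurable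
  · simp only [Function.comp_def, id]
    rw [hX.integral_sub_forecast hσ (hgt z), zero_mul]

end RandomLastSample

end RemoteEstimation

/-! ### The queue and the information received -/

namespace RemoteEstimation

variable {Ω : Type*} {X : ℝ≥0 → Ω → ℝ} {S Y D : ℕ → Ω → ℝ≥0} {t : ℝ≥0}

theorem deliveryTime_mono (S Y : ℕ → Ω → ℝ≥0) (ω : Ω) :
    Monotone fun i => deliveryTime S Y i ω :=
  monotone_nat_of_le_succ fun i => (le_self_add).trans (deliveryTime_add_le S Y i ω)

theorem measurable_deliveryTime {m : MeasurableSpace Ω} (hS : ∀ i, Measurable[m] (S i))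
    (hY : ∀ i, Measurable[m] (Y i)) (i : ℕ) : Measurable[m] (deliveryTime S Y i) := by
  induction i with
  | zero => exact (hS 0).add (hY 0)
  | succ i ih => exact ((hS (i + 1)).max ih).add (hY (i + 1))

/-- The value `f i` attached to the last sample `i < n` delivered by time `t`, and `a` if there is
no such sample. -/
noncomputable def lastReceived {β : Type*} (D : ℕ → Ω → ℝ≥0) (t : ℝ≥0) (a : β) (f : ℕ → Ω → β) :
    ℕ → Ω → β
  | 0, _ => a
  | n + 1, ω => if D n ω ≤ t then f n ω else lastReceived D t a f n ω

theorem lastReceived_le (hmono : ∀ i ω, S i ω ≤ S (i + 1) ω) (n : ℕ) (ω : Ω) :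
    lastReceived D t 0 S n ω ≤ S n ω := by
  induction n with
  | zero => exact zero_le
  | succ n ih =>
    rw [lastReceived]
    split_ifs
    · exact hmono n ω
    · exact ih.trans (hmono n ω)

theorem lastReceived_mono (hmono : ∀ i ω, S i ω ≤ S (i + 1) ω) (ω : Ω) :
    Monotone fun n => lastReceived D t 0 S n ω :=
  monotone_nat_of_le_succ fun n => by
    change _ ≤ if D n ω ≤ t then S n ω else lastReceived D t 0 S n ω
    split_ifs
    · exact lastReceived_le hmono n ω
    · exact le_rfl

theorem bddAbove_received (hSD : ∀ i ω, S i ω ≤ D i ω) (t : ℝ≥0) (ω : Ω) :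
    BddAbove {s | ∃ i, D i ω ≤ t ∧ s = S i ω} :=
  ⟨t, by rintro _ ⟨i, hi, rfl⟩; exact (hSD i ω).trans hi⟩

theorem freshestSamplingTime_le (hSD : ∀ i ω, S i ω ≤ D i ω) (t : ℝ≥0) (ω : Ω) :
    freshestSamplingTime S D t ω ≤ t :=
  csSup_le' <| by rintro _ ⟨i, hi, rfl⟩; exact (hSD i ω).trans hi

theorem le_freshestSamplingTime (hSD : ∀ i ω, S i ω ≤ D i ω) {i : ℕ} {ω : Ω} (hi : D i ω ≤ t) :
    S i ω ≤ freshestSamplingTime S D t ω :=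
  le_csSup (bddAbove_received hSD t ω) ⟨i, hi, rfl⟩

theorem lastReceived_le_freshestSamplingTime (hSD : ∀ i ω, S i ω ≤ D i ω) (n : ℕ) (ω : Ω) :
    lastReceived D t 0 S n ω ≤ freshestSamplingTime S D t ω := by
  induction n with
  | zero => exact zero_le
  | succ n ih =>
    rw [lastReceived]
    split_ifs with h
    · exact le_freshestSamplingTime hSD h
    · exact ih

/-- Sampling times are nondecreasing, so the last delivered sample among the first `n` is also the
freshest of them. The limit handles infinitely many deliveries by time `t` and transfers
measurability to the supremum. -/
theorem tendsto_lastReceived (hSD : ∀ i ω, S i ω ≤ D i ω)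
    (hmono : ∀ i ω, S i ω ≤ S (i + 1) ω) (t : ℝ≥0) (ω : Ω) :
    Filter.Tendsto (fun n => lastReceived D t 0 S n ω) Filter.atTop
      (nhds (freshestSamplingTime S D t ω)) := by
  have hbdd : BddAbove (Set.range fun n => lastReceived D t 0 S n ω) :=
    ⟨_, by rintro _ ⟨n, rfl⟩; exact lastReceived_le_freshestSamplingTime hSD n ω⟩
  have h : freshestSamplingTime S D t ω = ⨆ n, lastReceived D t 0 S n ω := by
    refine le_antisymm (csSup_le' ?_)
      (ciSup_le' fun n => lastReceived_le_freshestSamplingTime hSD n ω)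
    rintro _ ⟨i, hi, rfl⟩
    have h1 : lastReceived D t 0 S (i + 1) ω = S i ω := if_pos hi
    rw [← h1]
    exact le_ciSup hbdd (i + 1)
  rw [h]
  exact tendsto_atTop_ciSup (lastReceived_mono hmono ω) hbdd

/-- The default value `x₀` matches the default time `0`, so the absence of deliveries is no
exception. -/
theorem lastReceived_signal {x₀ : ℝ} {ω : Ω} (h0 : X 0 ω = x₀) (n : ℕ) :
    lastReceived D t x₀ (fun i ω => X (S i ω) ω) n ω = X (lastReceived D t 0 S n ω) ω := by
  induction n with
  | zero => exact h0.symm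
  | succ n ih =>
    simp only [lastReceived]
    split_ifs
    · rfl
    · exact ih

theorem measurable_lastReceived {m : MeasurableSpace Ω} {β : Type*} [MeasurableSpace β] {a : β}
    {f : ℕ → Ω → β} (hD : ∀ i, Measurable[m] (D i)) (hf : ∀ i, Measurable[m] (f i)) (n : ℕ) :
    Measurable[m] (lastReceived D t a f n) := by
  induction n with
  | zero => exact measurable_const
  | succ n ih => exact Measurable.ite (measurableSet_le (hD n) measurable_const) (hf n) ih

theorem measurable_freshestSamplingTime {m : MeasurableSpace Ω} (hS : ∀ i, Measurable[m] (S i))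
    (hD : ∀ i, Measurable[m] (D i)) (hSD : ∀ i ω, S i ω ≤ D i ω)
    (hmono : ∀ i ω, S i ω ≤ S (i + 1) ω) (t : ℝ≥0) :
    Measurable[m] (freshestSamplingTime S D t) :=
  measurable_of_tendsto_metrizable (measurable_lastReceived hD hS)
    (tendsto_pi_nhds.2 (tendsto_lastReceived hSD hmono t))

/-- Packet `i` is observable only on the event `D i ≤ t`, and the recursion consults it only there.
-/
theorem measurable_receivedInfo_lastReceived {β : Type*} [MeasurableSpace β] {a : β}
    {φ : ℝ≥0 × ℝ × ℝ≥0 → β} (hφ : Measurable φ) (n : ℕ) :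
    Measurable[receivedInfo X S D t]
      (lastReceived D t a (fun i ω => φ (S i ω, X (S i ω) ω, D i ω)) n) := by
  have hgen : ∀ i, ∀ B : Set (ℝ≥0 × ℝ × ℝ≥0), MeasurableSet B →
      MeasurableSet[receivedInfo X S D t] {ω | D i ω ≤ t ∧ (S i ω, X (S i ω) ω, D i ω) ∈ B} :=
    fun i B hB => MeasurableSpace.measurableSet_generateFrom ⟨i, B, hB, rfl⟩
  induction n with
  | zero => exact measurable_const
  | succ n ih =>
    intro B hB
    have hset : lastReceived D t a (fun i ω => φ (S i ω, X (S i ω) ω, D i ω)) (n + 1) ⁻¹' B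
        = {ω | D n ω ≤ t ∧ (S n ω, X (S n ω) ω, D n ω) ∈ φ ⁻¹' B}
          ∪ ({ω | D n ω ≤ t ∧ (S n ω, X (S n ω) ω, D n ω) ∈ Set.univ}ᶜ
            ∩ lastReceived D t a (fun i ω => φ (S i ω, X (S i ω) ω, D i ω)) n ⁻¹' B) := by
      ext ω
      by_cases h : D n ω ≤ t <;> simp [lastReceived, h]
    rw [hset]
    exact (hgen n _ (hφ hB)).union ((hgen n _ MeasurableSet.univ).compl.inter (ih hB))

theorem measurable_receivedInfo_freshestSamplingTime (hSD : ∀ i ω, S i ω ≤ D i ω)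
    (hmono : ∀ i ω, S i ω ≤ S (i + 1) ω) (t : ℝ≥0) :
    Measurable[receivedInfo X S D t] (freshestSamplingTime S D t) :=
  @measurable_of_tendsto_metrizable _ _ (receivedInfo X S D t) _ _ _ _ _ _
    (fun n => measurable_receivedInfo_lastReceived (a := (0 : ℝ≥0)) measurable_fst n)
    (tendsto_pi_nhds.2 (tendsto_lastReceived hSD hmono t))

theorem measurable_comp_path {m : MeasurableSpace Ω} {B : ℝ≥0 → Ω → ℝ} {s : Ω → ℝ≥0}
    (hm : ∀ t, Measurable[m] (B t)) (hc : ∀ ω, Continuous fun t => B t ω)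
    (hs : Measurable[m] s) : Measurable[m] fun ω => B (s ω) ω :=
  (measurable_uncurry_of_continuous_of_measurable hc hm).comp (hs.prodMk measurable_id)

/-- The received packets are determined by the packet times and by the signal up to the freshest
sampling time. -/
theorem receivedInfo_le {m : MeasurableSpace Ω} (hc : ∀ ω, Continuous fun t => X t ω)
    (hS : ∀ i, Measurable[m] (S i)) (hD : ∀ i, Measurable[m] (D i))
    (hSD : ∀ i ω, S i ω ≤ D i ω)
    (hX : ∀ r, Measurable[m] fun ω => X (min r (freshestSamplingTime S D t ω)) ω) :
    receivedInfo X S D t ≤ m := by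
  refine MeasurableSpace.generateFrom_le ?_
  rintro _ ⟨i, B, hB, rfl⟩
  -- On `D i ≤ t` one has `S i ≤ U`, so stopping the signal at `U` leaves the packet unchanged.
  have hXi : Measurable[m] fun ω => X (min (S i ω) (freshestSamplingTime S D t ω)) ω :=
    measurable_comp_path (B := fun r ω => X (min r (freshestSamplingTime S D t ω)) ω) hX
      (fun ω => (hc ω).comp (continuous_id.min continuous_const)) (hS i)
  have hset : {ω | D i ω ≤ t ∧ (S i ω, X (S i ω) ω, D i ω) ∈ B}
      = {ω | D i ω ≤ t} ∩ (fun ω =>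
        (S i ω, X (min (S i ω) (freshestSamplingTime S D t ω)) ω, D i ω)) ⁻¹' B := by
    ext ω
    simp only [Set.mem_ofPred_eq, Set.mem_inter_iff, Set.mem_preimage]
    exact and_congr_right fun h => by rw [min_eq_left (le_freshestSamplingTime hSD h)]
  rw [hset]
  exact (measurableSet_le (hD i) measurable_const).inter (((hS i).prodMk (hXi.prodMk (hD i))) hB)

/-- Deliveries are ordered, so before `D 0` nothing has arrived and the supremum of the empty set is
`0` in `ℝ≥0`. -/
theorem age_eq {Δ₀ : ℝ} {ω : Ω} (hD : Monotone fun i => D i ω) (h : D 0 ω ≤ t ∨ Δ₀ = 0) :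
    age Δ₀ S D t ω = t - freshestSamplingTime S D t ω := by
  rw [age]
  split_ifs with h0
  · rfl
  · have : {s | ∃ i, D i ω ≤ t ∧ s = S i ω} = ∅ :=
      Set.eq_empty_of_forall_notMem fun s ⟨i, hi, _⟩ => h0 ((hD (Nat.zero_le i)).trans hi)
    rw [freshestSamplingTime, this, csSup_empty]
    simp [h.resolve_left h0]

theorem measurable_policyServiceInfo_sampling (S Y : ℕ → Ω → ℝ≥0) (i : ℕ) :
    Measurable[policyServiceInfo S Y] (S i) :=
  ((measurable_pi_apply i).comp measurable_fst).comp
    (comap_measurable fun ω => ((fun i => S i ω), fun i => Y i ω))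

theorem measurable_policyServiceInfo_service (S Y : ℕ → Ω → ℝ≥0) (i : ℕ) :
    Measurable[policyServiceInfo S Y] (Y i) :=
  ((measurable_pi_apply i).comp measurable_snd).comp
    (comap_measurable fun ω => ((fun i => S i ω), fun i => Y i ω))

/-- Under a signal-agnostic policy, the freshest sampling time is a bounded measurable function of
the packet times. -/
theorem exists_freshestSamplingTime_eq (hmono : ∀ i ω, S i ω ≤ S (i + 1) ω) (t : ℝ≥0) :
    ∃ g : (ℕ → ℝ≥0) × (ℕ → ℝ≥0) → ℝ≥0, Measurable g ∧ (∀ z, g z ≤ t) ∧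
      ∀ ω, freshestSamplingTime S (deliveryTime S Y) t ω
        = g ((fun i => S i ω), fun i => Y i ω) := by
  have hSD : ∀ i ω, S i ω ≤ deliveryTime S Y i ω := fun i ω =>
    le_self_add.trans (add_le_deliveryTime S Y i ω)
  have hU := measurable_freshestSamplingTime (measurable_policyServiceInfo_sampling S Y)
    (measurable_deliveryTime (measurable_policyServiceInfo_sampling S Y)
      (measurable_policyServiceInfo_service S Y)) hSD hmono t
  obtain ⟨g, hg, hgU⟩ := hU.exists_eq_measurable_comp
  -- The factorization controls `g` only at attained values of `(S, Y)`; truncation at `t` gives the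
  -- bound at every frozen `z`.
  refine ⟨fun z => min (g z) t, hg.min measurable_const, fun z => min_le_right _ _, fun ω => ?_⟩
  have h := congrFun hgU ω
  simp only [Function.comp_apply] at h
  change _ = min (g _) t
  rw [← h, min_eq_left (freshestSamplingTime_le hSD t ω)]

/-! ### Identification of the estimator -/

section Estimator

variable [MeasurableSpace Ω] {P : Measure Ω} [IsProbabilityMeasure P] {θ μ σ x₀ : ℝ}
  {W : ℝ≥0 → Ω → ℝ}

theorem IsOrnsteinUhlenbeck.integrable (hX : IsOrnsteinUhlenbeck P θ μ σ x₀ W X) (hσ : σ ≠ 0)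
    (t : ℝ≥0) : Integrable (X t) P := by
  have h := ((hX.memLp_two_sub_forecast hσ (zero_le (a := t))).integrable one_le_two).add
    (integrable_const (forecast θ μ t x₀))
  refine h.congr ?_
  filter_upwards [hX.eval_zero] with ω h0
  simp [h0]

/-- The minimum mean-squared error estimator propagates the freshest received sample along the
mean dynamics. -/
theorem estimator_ae_eq (hX : IsOrnsteinUhlenbeck P θ μ σ x₀ W X) (hθ : 0 < θ) (hσ : σ ≠ 0)
    (hY : ∀ i, Measurable (Y i)) (hS : IsSignalAgnostic P X S Y) (t : ℝ≥0) :
    estimator P X S (deliveryTime S Y) t =ᵐ[P] fun ω =>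
      forecast θ μ (t - freshestSamplingTime S (deliveryTime S Y) t ω)
        (X (freshestSamplingTime S (deliveryTime S Y) t ω) ω) := by
  have hXc := hX.continuous_paths
  have hSD : ∀ i ω, S i ω ≤ deliveryTime S Y i ω := fun i ω =>
    le_self_add.trans (add_le_deliveryTime S Y i ω)
  obtain ⟨g, hg, hgt, hUg⟩ := exists_freshestSamplingTime_eq (Y := Y) hS.mono t
  have hDm := measurable_deliveryTime hS.measurable hY
  have hZ : Measurable fun ω => ((fun i => S i ω), fun i => Y i ω) :=
    (measurable_pi_lambda _ hS.measurable).prodMk (measurable_pi_lambda _ hY)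
  have hUm := measurable_freshestSamplingTime hS.measurable hDm hSD hS.mono t
  have hle : receivedInfo X S (deliveryTime S Y) t ≤ ‹MeasurableSpace Ω› :=
    receivedInfo_le hXc hS.measurable hDm hSD fun r =>
      measurable_comp_path hX.measurable hXc (measurable_const.min hUm)
  -- The larger σ-field, policy together with the signal stopped at `U`, is the one for which
  -- orthogonality of the error is known.
  have hle' : receivedInfo X S (deliveryTime S Y) t ≤ MeasurableSpace.comap
      (fun ω => (((fun i => S i ω), fun i => Y i ω),
        fun r => X (min r (g ((fun i => S i ω), fun i => Y i ω))) ω))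
      (inferInstance : MeasurableSpace
        (((ℕ → ℝ≥0) × (ℕ → ℝ≥0)) × (ℝ≥0 → ℝ))) := by
    set K := fun ω => (((fun i => S i ω), fun i => Y i ω),
        fun r => X (min r (g ((fun i => S i ω), fun i => Y i ω))) ω)
    have hKm : Measurable[MeasurableSpace.comap K inferInstance] K := comap_measurable K
    have hZm := measurable_fst.comp hKm
    have hSm : ∀ i, Measurable[MeasurableSpace.comap K inferInstance] (S i) := fun i =>
      ((measurable_pi_apply i).comp measurable_fst).comp hZm
    have hYm : ∀ i, Measurable[MeasurableSpace.comap K inferInstance] (Y i) := fun i =>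
      ((measurable_pi_apply i).comp measurable_snd).comp hZm
    refine receivedInfo_le hXc hSm (measurable_deliveryTime hSm hYm) hSD fun r => ?_
    simp_rw [hUg]
    exact ((measurable_pi_apply r).comp measurable_snd).comp hKm
  -- A version of `X` at time `U` that is measurable for the received packets. The limsup is
  -- measurable without any convergence, and off the null set where `X 0 ≠ x₀` it is the limit of
  -- the received values.
  set V : Ω → ℝ := fun ω => Filter.limsup (fun n =>
    lastReceived (deliveryTime S Y) t x₀ (fun i ω => X (S i ω) ω) n ω) Filter.atTop with hV
  have hVX : V =ᵐ[P] fun ω => X (freshestSamplingTime S (deliveryTime S Y) t ω) ω := by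
    filter_upwards [hX.eval_zero] with ω h0
    simp only [hV, lastReceived_signal h0]
    exact (((hXc ω).tendsto _).comp (tendsto_lastReceived hSD hS.mono t ω)).limsup_eq
  have hfV : (fun ω => forecast θ μ (t - freshestSamplingTime S (deliveryTime S Y) t ω) (V ω))
      =ᵐ[P] fun ω => forecast θ μ (t - freshestSamplingTime S (deliveryTime S Y) t ω)
        (X (freshestSamplingTime S (deliveryTime S Y) t ω) ω) := by
    filter_upwards [hVX] with ω h
    rw [h]
  have herr := hX.integrable_sub_forecast_of_indepFun hθ hσ hZ hS.indep hg hgt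
  simp_rw [← hUg] at herr
  have hXt := hX.integrable hσ t
  have hint : Integrable (fun ω => forecast θ μ
      (t - freshestSamplingTime S (deliveryTime S Y) t ω)
        (X (freshestSamplingTime S (deliveryTime S Y) t ω) ω)) P :=
    (hXt.sub herr).congr (Filter.Eventually.of_forall fun ω => sub_sub_cancel _ _)
  refine Filter.EventuallyEq.trans ?_ hfV
  symm
  refine ae_eq_condExp_of_forall_setIntegral_eq hle hXt
    (fun _ _ _ => (hint.congr hfV.symm).integrableOn) (fun A hA _ => ?_) ?_
  · rw [setIntegral_congr_ae (hle _ hA) (hfV.mono fun ω h _ => h)]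
    have h0 := hX.setIntegral_sub_forecast_of_indepFun hθ hσ hZ hS.indep hg hgt (hle' _ hA)
    simp_rw [← hUg] at h0
    rw [integral_sub hXt.integrableOn hint.integrableOn] at h0
    linarith
  · have hUr : Measurable[receivedInfo X S (deliveryTime S Y) t]
        (freshestSamplingTime S (deliveryTime S Y) t) :=
      measurable_receivedInfo_freshestSamplingTime hSD hS.mono t
    have hVr : Measurable[receivedInfo X S (deliveryTime S Y) t] V :=
      Measurable.limsup fun n =>
        measurable_receivedInfo_lastReceived (measurable_fst.comp measurable_snd) n
    have hf : Measurable fun p : ℝ≥0 × ℝ => forecast θ μ (t - p.1) p.2 := by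
      unfold forecast
      fun_prop
    exact (hf.comp (hUr.prodMk hVr)).stronglyMeasurable.aestronglyMeasurable

end Estimator

end RemoteEstimation

/-! ### The conditional mean-squared error -/

theorem mainTheorem10 {Ω : Type*} [MeasurableSpace Ω] (P : Measure Ω) [IsProbabilityMeasure P]
    (θ μ σ x₀ Δ₀ : ℝ) (hθ : 0 < θ) (hσ : 0 < σ)
    (W X : ℝ≥0 → Ω → ℝ) (hX : RemoteEstimation.IsOrnsteinUhlenbeck P θ μ σ x₀ W X)
    (Y : ℕ → Ω → ℝ≥0) (hY : RemoteEstimation.IsServiceSequence P Y)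
    (S : ℕ → Ω → ℝ≥0) (hS : RemoteEstimation.IsSignalAgnostic P X S Y)
    (D : ℕ → Ω → ℝ≥0) (hD : D = RemoteEstimation.deliveryTime S Y) :
    (∀ t : ℝ≥0,
      Integrable (fun ω => (X t ω - RemoteEstimation.estimator P X S D t ω) ^ 2) P ∧
      ∀ᵐ ω ∂P, (D 0 ω ≤ t ∨ Δ₀ = 0) →
        (P[fun ω' => (X t ω' - RemoteEstimation.estimator P X S D t ω') ^ 2 |
            RemoteEstimation.policyServiceInfo S Y]) ω =
          RemoteEstimation.agePenalty θ σ (RemoteEstimation.age Δ₀ S D t ω)) ∧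
    StrictMono (RemoteEstimation.agePenalty θ σ) := by
  subst hD
  have hSD : ∀ i ω, S i ω ≤ RemoteEstimation.deliveryTime S Y i ω := fun i ω =>
    le_self_add.trans (RemoteEstimation.add_le_deliveryTime S Y i ω)
  refine ⟨fun t => ?_, RemoteEstimation.agePenalty_strictMono hθ hσ.ne'⟩
  obtain ⟨g, hg, hgt, hUg⟩ := RemoteEstimation.exists_freshestSamplingTime_eq (Y := Y) hS.mono t
  have hZ : Measurable fun ω => ((fun i => S i ω), fun i => Y i ω) :=
    (measurable_pi_lambda _ hS.measurable).prodMk (measurable_pi_lambda _ hY.measurable)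
  have hint := hX.integrable_sub_forecast_sq_of_indepFun hθ hσ.ne' hZ hS.indep hg hgt
  have hcond := hX.condExp_sub_forecast_sq_of_indepFun hθ hσ.ne' hZ hS.indep hg hgt
  simp_rw [← hUg] at hint hcond
  have herr : (fun ω => (X t ω - RemoteEstimation.forecast θ μ
        (t - RemoteEstimation.freshestSamplingTime S (RemoteEstimation.deliveryTime S Y) t ω)
        (X (RemoteEstimation.freshestSamplingTime S (RemoteEstimation.deliveryTime S Y) t ω) ω)) ^ 2)
      =ᵐ[P] fun ω => (X t ω -
        RemoteEstimation.estimator P X S (RemoteEstimation.deliveryTime S Y) t ω) ^ 2 := by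
    filter_upwards [RemoteEstimation.estimator_ae_eq hX hθ hσ.ne' hY.measurable hS t] with ω h
    rw [h]
  refine ⟨hint.congr herr, ?_⟩
  filter_upwards [condExp_congr_ae (m := RemoteEstimation.policyServiceInfo S Y) herr, hcond]
    with ω h1 h2 h
  rw [← h1, h2, RemoteEstimation.age_eq (RemoteEstimation.deliveryTime_mono S Y ω) h]
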